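/- For $N\ge 2$ and $a>0$ let $V_{N,a}$ be the set of continuous functions $g:\mathbb{R}\to\mathbb{R}$ with $\operatorname{supp} g=[-\frac N2,\frac N2]$ such that (A1) $g(-x)=g(x)$ for all $x\in\mathbb{R}$; (A2) $g$ is strictly increasing on $[-\frac N2,0]$; (A3) with $\Delta_a^2g(x)=g(x)-2g(x-a)+g(x-2a)$: if $a<\frac N3$, then $\Delta_a^2g(x)\ge 0$ for all $x\in[-\frac N2,-\frac N4+\frac{3a}4]$; if $a\ge\frac N3$, then $\Delta_a^2g(x)\ge0$ for all $x\in[-\frac N2,0]\cup\{-\frac N4+\frac{3a}4\}$. For $a,b>0$ and $g\in L^2(\mathbb{R})$, let $\mathcal G(g,a,b)=\{e^{2\pi i\ell b\,\cdot}\,g(\cdot-ka):(\ell,k)\in\mathbb{Z}^2\}$; it is a frame for $L^2(\mathbb{R})$ if there exist $A,B>0$ such that $$A\|f\|_2^2\le\sum_{\ell,k\in\mathbb{Z}}\bigl|\langle f,e^{2\pi i\ell b\,\cdot}g(\cdot-ka)\rangle\bigr|^2\le B\|f\|_2^2\qquad\text{for all } f\in L^2(\mathbb{R}).$$ Let $$T_1=\Bigl\{(a,b)\in\mathbb{R}_+^2:\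 a\in\bigl(0,\tfrac N2\bigr),\ b\in\bigl(0,\tfrac{2}{N+a}\bigr],\ b<\tfrac2N\Bigr\},$$ and for $m\ge2$ $$T_m=\Bigl\{(a,b)\in\mathbb{R}_+^2:\ a\in\bigl(\tfrac{N(m-2)}{2m-3},\tfrac N2\bigr),\ b\in\bigl(\tfrac{2(m-1)}{N+(2m-3)a},\tfrac{2m}{N+(2m-1)a}\bigr],\ b<\tfrac2N\Bigr\},$$ and $T=\bigcup_{m=1}^{\infty}T_m$. **Corollary.** Let $a>0$, $N\ge2$ and $g\in V_{N,a}$. If $(a,b)\in T$, then $\mathcal G(g,a,b)$ is a frame for $L^2(\mathbb{R})$. -/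

import Mathlib

open MeasureTheory

namespace GaborFrames

noncomputable section

/-- A family `φ` in a complex Hilbert space is a frame if there are constants `A, B > 0` such that
`A ‖f‖² ≤ ∑ᵢ |⟨f, φᵢ⟩|² ≤ B ‖f‖²` for every `f` (the sum being convergent). -/
def IsHilbertFrame {ι H : Type*} [NormedAddCommGroup H] [InnerProductSpace ℂ H]
    (φ : ι → H) : Prop :=
  ∃ A B : ℝ, 0 < A ∧ 0 < B ∧ ∀ f : H,
    Summable (fun i => ‖inner ℂ (φ i) f‖ ^ 2) ∧
    A * ‖f‖ ^ 2 ≤ ∑' i, ‖inner ℂ (φ i) f‖ ^ 2 ∧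
    ∑' i, ‖inner ℂ (φ i) f‖ ^ 2 ≤ B * ‖f‖ ^ 2

/-- The time-frequency shift `M_{ℓ b} T_{k a} g`, that is `x ↦ exp(2 π i ℓ b x) g(x - k a)`. -/
def gaborAtom (g : ℝ → ℂ) (a b : ℝ) (ℓ k : ℤ) : ℝ → ℂ :=
  fun x => Complex.exp (2 * Real.pi * Complex.I * ℓ * b * x) * g (x - k * a)

theorem memLp_gaborAtom {g : ℝ → ℂ} (hg : MemLp g 2 volume) (a b : ℝ) (ℓ k : ℤ) :
    MemLp (gaborAtom g a b ℓ k) 2 volume := by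
  have h1 : MemLp (fun x => g (x - k * a)) 2 volume :=
    hg.comp_measurePreserving (measurePreserving_sub_right volume ((k : ℝ) * a))
  have hc : Continuous fun x : ℝ =>
      Complex.exp (2 * Real.pi * Complex.I * ℓ * b * x) := by fun_prop
  refine h1.of_le (hc.aestronglyMeasurable.mul h1.1) (Filter.Eventually.of_forall fun x => ?_)
  have h2 : (2 * Real.pi * Complex.I * ℓ * b * x : ℂ)
      = ((2 * Real.pi * ℓ * b * x : ℝ) : ℂ) * Complex.I := by
    push_cast; ring
  rw [gaborAtom, norm_mul, h2, Complex.norm_exp_ofReal_mul_I, one_mul]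

/-- The Gabor system `𝒢(g, a, b)` as a family in `L²(ℝ)` indexed by `(ℓ, k) ∈ ℤ²`. -/
def gaborSystem (g : ℝ → ℂ) (hg : MemLp g 2 volume) (a b : ℝ) :
    ℤ × ℤ → Lp ℂ 2 (volume : Measure ℝ) :=
  fun p => (memLp_gaborAtom hg a b p.1 p.2).toLp (gaborAtom g a b p.1 p.2)

/-- `g ∈ L²(ℝ)` and `𝒢(g, a, b)` is a frame for `L²(ℝ)`. -/
def IsGaborFrame (g : ℝ → ℂ) (a b : ℝ) : Prop :=
  ∃ hg : MemLp g 2 volume, IsHilbertFrame (gaborSystem g hg a b)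

/-- `Δ²_a g(x) = g(x) - 2 g(x - a) + g(x - 2a)`. -/
def secondDiff (a : ℝ) (g : ℝ → ℝ) (x : ℝ) : ℝ :=
  g x - 2 * g (x - a) + g (x - 2 * a)

/-- The class `V_{N,a}` of generalized B-splines. -/
structure IsGeneralizedBSpline (N a : ℝ) (g : ℝ → ℝ) : Prop where
  continuous : Continuous g
  support_eq : tsupport g = Set.Icc (-(N / 2)) (N / 2)
  even : ∀ x, g (-x) = g x
  strictMonoOn : StrictMonoOn g (Set.Icc (-(N / 2)) 0)
  secondDiff_nonneg_of_lt : a < N / 3 →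
    ∀ x ∈ Set.Icc (-(N / 2)) (-(N / 4) + 3 * a / 4), 0 ≤ secondDiff a g x
  secondDiff_nonneg_of_ge : N / 3 ≤ a →
    ∀ x ∈ Set.Icc (-(N / 2)) 0 ∪ {-(N / 4) + 3 * a / 4}, 0 ≤ secondDiff a g x

/-- The regions `T_m`, `m ≥ 1`; the case `m = 1` has its own formula. -/
def regionT (N : ℝ) (m : ℕ) : Set (ℝ × ℝ) :=
  if m = 1 then
    {p | 0 < p.1 ∧ 0 < p.2 ∧ p.1 ∈ Set.Ioo 0 (N / 2) ∧
      p.2 ∈ Set.Ioc 0 (2 / (N + p.1)) ∧ p.2 < 2 / N}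
  else
    {p | 0 < p.1 ∧ 0 < p.2 ∧ p.1 ∈ Set.Ioo (N * (m - 2) / (2 * m - 3)) (N / 2) ∧
      p.2 ∈ Set.Ioc (2 * (m - 1) / (N + (2 * m - 3) * p.1)) (2 * m / (N + (2 * m - 1) * p.1)) ∧
      p.2 < 2 / N}

/-- `T = ⋃_{m ≥ 1} T_m`. -/
def unionT (N : ℝ) : Set (ℝ × ℝ) :=
  ⋃ (m : ℕ) (_ : 1 ≤ m), regionT N m

end

end GaborFrames

/-!
Write `P = 1 / b`. Parseval's identity on one period turns the frame operator into a statement about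
the `P`-periodic functions `F_k(x) = ∑ₙ f (x + n P) g (x + n P - k a)` (`fibre`): the coefficients of
`f` against all modulations of the window at `k a` have square sum `P ∫ |F_k|²` over one period
(`tsum_sq_enorm_inner_gaborSystem`). As `N / 2 < P`, only two terms of `F_k` survive on a suitable
period, and the upper frame bound follows because the shifted windows overlap boundedly often.

For the lower bound, `f x` has to be recovered from finitely many `F_k(x)`. Put `x` within `a / 2` of
a window centre and let `M + 1` be the index `m` of the region `T_m`. The `2 M + 1` windows nearest
to `x` give a system for the values `f (x + n P)`, whose diagonal positions are
`y_k = x + k (P - a)`, `|k| ≤ M`. The bounds on `b` say that these lie inside the support of `g`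
while the outermost rows do not reach any unknown with `|n| > M`. Because `N / 2 < P`, row `k` has at
most one further entry, towards `k + 1` if `y_k < 0` and towards `k - 1` if `y_k ≥ 0`. So the system
is triangular apart from a single `2 × 2` block, at the sign change `u < 0 ≤ v` of the `y_k`, with
determinant `g u * g v - g (u - a) * g (v + a)`. This is positive since `g` increases up to `0` and
decreases afterwards (`norm_le_of_pair`), and compactness makes all bounds uniform in `x`
(`exists_sq_norm_le_sum_fibre`). As `a < P`, the points having a given nearest window lie in one
period, so integration over `x` yields the lower frame bound (`lintegral_sq_enorm_le_tsum_fibre`).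
-/

namespace GaborFrames

/-! ### The shape of the window -/

namespace IsGeneralizedBSpline

variable {N a : ℝ} {g : ℝ → ℝ}

theorem eq_zero (hg : IsGeneralizedBSpline N a g) {x : ℝ} (hx : N / 2 ≤ |x|) : g x = 0 := by
  have hout : ∀ y, N / 2 < y → g y = 0 := fun y hy => by
    refine image_eq_zero_of_notMem_tsupport fun h => ?_
    rw [hg.support_eq] at h
    linarith [h.2]
  have habs : g x = g |x| := by
    rcases abs_choice x with h | h <;> rw [h]
    exact (hg.even x).symm
  rw [habs]
  have hcl : IsClosed {y | g y = 0} := isClosed_eq hg.continuous continuous_const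
  have hsub : closure (Set.Ioi (N / 2)) ⊆ {y | g y = 0} := hcl.closure_subset_iff.2 hout
  rw [closure_Ioi] at hsub
  exact hsub hx

theorem pos (hg : IsGeneralizedBSpline N a g) {x : ℝ} (hx : |x| < N / 2) : 0 < g x := by
  have habs : g x = g (-|x|) := by
    rcases abs_choice x with h | h <;> rw [h]
    · exact (hg.even x).symm
    · rw [neg_neg]
  have h0 : g (-(N / 2)) = 0 := hg.eq_zero (by rw [abs_neg]; exact le_abs_self _)
  have hx0 := abs_nonneg x
  rw [habs, ← h0]
  exact hg.strictMonoOn ⟨le_rfl, by linarith⟩ ⟨by linarith, by linarith⟩ (by linarith)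

theorem nonneg (hg : IsGeneralizedBSpline N a g) (x : ℝ) : 0 ≤ g x := by
  rcases lt_or_ge |x| (N / 2) with h | h
  · exact (hg.pos h).le
  · exact (hg.eq_zero h).ge

theorem lt_of_lt_of_nonpos (hg : IsGeneralizedBSpline N a g) {x y : ℝ} (hxy : x < y)
    (hy : y ≤ 0) (hyN : -(N / 2) < y) : g x < g y := by
  rcases lt_or_ge x (-(N / 2)) with h | h
  · rw [hg.eq_zero (x := x) (by rw [abs_of_neg (by linarith)]; linarith)]
    exact hg.pos (by rw [abs_of_nonpos hy]; linarith)
  · exact hg.strictMonoOn ⟨h, by linarith⟩ ⟨hyN.le, hy⟩ hxy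

theorem le_of_nonneg_of_le (hg : IsGeneralizedBSpline N a g) {x y : ℝ} (hx : 0 ≤ x)
    (hxy : x ≤ y) : g y ≤ g x := by
  rcases lt_or_ge y (N / 2) with h | h
  · rcases hxy.eq_or_lt with rfl | hlt
    · exact le_rfl
    · rw [← hg.even x, ← hg.even y]
      exact (hg.lt_of_lt_of_nonpos (by linarith) (by linarith) (by linarith)).le
  · rw [hg.eq_zero (x := y) (h.trans (le_abs_self y))]
    exact hg.nonneg x

theorem le_apply_zero (hg : IsGeneralizedBSpline N a g) (x : ℝ) : g x ≤ g 0 := by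
  rcases le_total 0 x with h | h
  · exact hg.le_of_nonneg_of_le le_rfl h
  · rw [← hg.even x]
    exact hg.le_of_nonneg_of_le le_rfl (by linarith)

theorem exists_pos_le (hg : IsGeneralizedBSpline N a g) {ρ : ℝ} (hρ : ρ < N / 2) :
    ∃ γ > 0, ∀ y, |y| ≤ ρ → γ ≤ g y := by
  rcases lt_or_ge ρ 0 with h | h
  · exact ⟨1, one_pos, fun y hy => absurd (abs_nonneg y) (by linarith)⟩
  · obtain ⟨z, hz, hmin⟩ := isCompact_Icc.exists_isMinOn
      (Set.nonempty_Icc.2 (by linarith : -ρ ≤ ρ)) hg.continuous.continuousOn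
    exact ⟨g z, hg.pos ((abs_le.2 hz).trans_lt hρ), fun y hy => hmin (abs_le.1 hy)⟩

theorem exists_pos_le_sub (hg : IsGeneralizedBSpline N a g) (ha : 0 < a) {ρ : ℝ}
    (hρ : ρ < N / 2) : ∃ η > 0, ∀ u, -ρ ≤ u → u ≤ 0 → η ≤ g u - g (u - a) := by
  rcases lt_or_ge ρ 0 with h | h
  · exact ⟨1, one_pos, fun y hy hy' => by linarith⟩
  · have hc : Continuous fun u => g u - g (u - a) := by
      have := hg.continuous
      fun_prop
    obtain ⟨z, hz, hmin⟩ := isCompact_Icc.exists_isMinOn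
      (Set.nonempty_Icc.2 (by linarith : -ρ ≤ 0)) hc.continuousOn
    refine ⟨g z - g (z - a), sub_pos.2 (hg.lt_of_lt_of_nonpos (by linarith) hz.2 ?_),
      fun u h1 h2 => hmin ⟨h1, h2⟩⟩
    linarith [hz.1]

end IsGeneralizedBSpline

/-! ### Inverting the tridiagonal system -/

/-- The two rows on either side of the sign change of the diagonal positions couple only with each
other. The matrix of this pair has entries `g u, g (v + a)` and `g (u - a), g v`; its determinant
is positive because `g` increases up to `0` and decreases after it. -/
theorem norm_le_of_pair {N a : ℝ} {g : ℝ → ℝ} (hg : IsGeneralizedBSpline N a g) (ha : 0 < a)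
    {γ η S u v : ℝ} (hγ : 0 < γ) (hη : 0 < η) (hv0 : 0 ≤ v) (hγv : γ ≤ g v)
    (hηu : η ≤ g u - g (u - a)) {p q : ℂ}
    (h1 : ‖p * g u + q * g (v + a)‖ ≤ S) (h2 : ‖q * g v + p * g (u - a)‖ ≤ S) :
    ‖q‖ ≤ 2 * g 0 / (η * γ) * S := by
  have key : q * ((g u * g v - g (u - a) * g (v + a) : ℝ) : ℂ)
      = (q * g v + p * g (u - a)) * g u - (p * g u + q * g (v + a)) * g (u - a) := by
    push_cast
    ring
  have hva := hg.le_of_nonneg_of_le hv0 (by linarith : v ≤ v + a)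
  have hua := hg.nonneg (u - a)
  have hdet : η * γ ≤ g u * g v - g (u - a) * g (v + a) :=
    calc η * γ ≤ (g u - g (u - a)) * g v := by gcongr; linarith
      _ ≤ g u * g v - g (u - a) * g (v + a) := by nlinarith
  have hbound : ‖q * ((g u * g v - g (u - a) * g (v + a) : ℝ) : ℂ)‖ ≤ S * g 0 + S * g 0 := by
    rw [key]
    refine (norm_sub_le _ _).trans ?_
    have hS : 0 ≤ S := (norm_nonneg _).trans h1
    have hn : ∀ y, ‖(g y : ℂ)‖ ≤ g 0 := fun y => by
      rw [Complex.norm_real, Real.norm_of_nonneg (hg.nonneg y)]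
      exact hg.le_apply_zero y
    rw [norm_mul, norm_mul]
    exact add_le_add (mul_le_mul h2 (hn _) (norm_nonneg _) hS)
      (mul_le_mul h1 (hn _) (norm_nonneg _) hS)
  have hpos : 0 < η * γ := by positivity
  rw [norm_mul, Complex.norm_real, Real.norm_of_nonneg (hpos.le.trans hdet)] at hbound
  have := mul_le_mul_of_nonneg_left hdet (norm_nonneg q)
  rw [div_mul_eq_mul_div, le_div_iff₀ hpos]
  linarith

/-- Row `k` of the system, with diagonal position `x + k (P - a)`. -/
def row (g : ℝ → ℝ) (a P x : ℝ) (c : ℤ → ℂ) (k : ℤ) : ℂ :=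
  c k * g (x + k * (P - a)) + c (k + 1) * g (x + k * (P - a) + P)
    + c (k - 1) * g (x + k * (P - a) - P)

/-- Solving the rows from the most negative index upwards: each row whose diagonal position is
nonnegative involves, besides `c k`, only `c (k - 1)`. The constant depends on the number of rows
passed, and not on `x`. -/
theorem exists_norm_le_of_nonneg {N a P : ℝ} {g : ℝ → ℝ} (hg : IsGeneralizedBSpline N a g)
    (ha : 0 < a) (hP : N / 2 < P) (haP : a < P) {M : ℕ}
    (hM : a / 2 + M * (P - a) < N / 2) (hM' : N / 2 ≤ a / 2 + (M + 1) * (P - a)) (j : ℕ) :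
    ∃ K : ℝ, 0 ≤ K ∧ ∀ (x : ℝ) (c : ℤ → ℂ) (S : ℝ), |x| ≤ a / 2 →
      (∀ k : ℤ, |k| ≤ M → ‖row g a P x c k‖ ≤ S) → j ≤ M →
      0 ≤ x + ((j - M : ℤ) : ℝ) * (P - a) → ‖c (j - M)‖ ≤ K * S := by
  obtain ⟨γ, hγ, hγle⟩ := hg.exists_pos_le hM
  obtain ⟨η, hη, hηle⟩ := hg.exists_pos_le_sub ha hM
  have hδ : 0 < P - a := by linarith
  have hG := hg.nonneg 0
  -- the diagonal positions of the rows with `|k| ≤ M` stay inside the support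
  have hdiag : ∀ (x : ℝ) (k : ℤ), |x| ≤ a / 2 → |k| ≤ M →
      |x + k * (P - a)| ≤ a / 2 + M * (P - a) := fun x k hx hk => by
    have hk' : |(k : ℝ)| ≤ M := by exact_mod_cast hk
    refine (abs_add_le _ _).trans (add_le_add hx ?_)
    rw [abs_mul, abs_of_pos hδ]
    gcongr
  have hright : ∀ y, 0 ≤ y → g (y + P) = 0 := fun y hy =>
    hg.eq_zero (le_trans (by linarith) (le_abs_self _))
  have hleft : ∀ y, y ≤ 0 → g (y - P) = 0 := fun y hy =>
    hg.eq_zero (le_trans (by linarith) (neg_le_abs _))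
  -- a row with known neighbour on the left determines the diagonal unknown
  have hstep : ∀ (y S D : ℝ) (p q : ℂ), γ ≤ g y → ‖p‖ ≤ D →
      ‖q * g y + p * g (y - P)‖ ≤ S → ‖q‖ ≤ (S + D * g 0) / γ := fun y S D p q hy hp hr => by
    have h1 : ‖q * g y‖ ≤ S + D * g 0 := by
      have h2 : q * g y = (q * g y + p * g (y - P)) - p * g (y - P) := by ring
      rw [h2]
      refine (norm_sub_le _ _).trans (add_le_add hr ?_)
      rw [norm_mul, Complex.norm_real, Real.norm_of_nonneg (hg.nonneg _)]
      exact mul_le_mul hp (hg.le_apply_zero _) (hg.nonneg _) ((norm_nonneg _).trans hp)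
    rw [norm_mul, Complex.norm_real, Real.norm_of_nonneg (hg.nonneg _)] at h1
    rw [le_div_iff₀ hγ]
    exact (mul_le_mul_of_nonneg_left hy (norm_nonneg q)).trans h1
  induction j with
  | zero =>
    refine ⟨1 / γ, by positivity, fun x c S hx hrow _ hy => ?_⟩
    have hk : |((0 : ℕ) - M : ℤ)| ≤ M := by simp
    have hr := hrow _ hk
    -- the left neighbour of the first row lies outside the support
    have hz : g (x + (((0 : ℕ) - M : ℤ) : ℝ) * (P - a) - P) = 0 := by
      refine hg.eq_zero (le_trans ?_ (neg_le_abs _))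
      push_cast
      have := (abs_le.1 hx).2
      linarith
    rw [row, hright _ hy, hz, Complex.ofReal_zero, mul_zero, mul_zero, add_zero, add_zero] at hr
    refine (hstep _ S 0 0 _ (hγle _ (hdiag x _ hx hk)) (by simp) ?_).trans (le_of_eq (by ring))
    rwa [zero_mul, add_zero]
  | succ j ih =>
    obtain ⟨K, hK, ih⟩ := ih
    refine ⟨2 * g 0 / (η * γ) + (1 + K * g 0) / γ, by positivity,
      fun x c S hx hrow hj hy => ?_⟩
    have hS : 0 ≤ S := (norm_nonneg _).trans (hrow 0 (by simp))
    have hk : |((j + 1 : ℕ) - M : ℤ)| ≤ M := by rw [abs_le]; constructor <;> push_cast <;> omega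
    have hk' : |(j - M : ℤ)| ≤ M := by rw [abs_le]; constructor <;> omega
    have hr := hrow _ hk
    have e1 : ((j + 1 : ℕ) - M : ℤ) - 1 = j - M := by push_cast; ring
    have e2 : (j - M : ℤ) + 1 = (j + 1 : ℕ) - M := by push_cast; ring
    have e3 : (((j + 1 : ℕ) - M : ℤ) : ℝ) = ((j - M : ℤ) : ℝ) + 1 := by push_cast; ring
    rw [row, hright _ hy, e1, Complex.ofReal_zero, mul_zero, add_zero] at hr
    rw [add_mul]
    rcases lt_or_ge (x + ((j - M : ℤ) : ℝ) * (P - a)) 0 with hneg | hnonneg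
    · have hr' := hrow _ hk'
      rw [row, hleft _ hneg.le, e2, Complex.ofReal_zero, mul_zero, add_zero] at hr'
      set u := x + ((j - M : ℤ) : ℝ) * (P - a) with hu
      have hv : x + (((j + 1 : ℕ) - M : ℤ) : ℝ) * (P - a) = u + (P - a) := by rw [e3, hu]; ring
      have hγv := hγle _ (hdiag x _ hx hk)
      rw [hv] at hr hy hγv
      have e4 : u + P = u + (P - a) + a := by ring
      have e5 : u + (P - a) - P = u - a := by ring
      rw [e4] at hr'
      rw [e5] at hr
      have := norm_le_of_pair hg ha hγ hη hy hγv
        (hηle u (neg_le_of_abs_le (hdiag x _ hx hk')) hneg.le) hr' hr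
      exact this.trans (le_add_of_nonneg_right (by positivity))
    · have hp := ih x c S hx hrow (by omega) hnonneg
      have := hstep _ S _ _ _ (hγle _ (hdiag x _ hx hk)) hp hr
      refine this.trans (le_trans (le_of_eq ?_) (le_add_of_nonneg_left (by positivity)))
      ring

/-- The central unknown is controlled by the `2 M + 1` rows around it, uniformly in `x`. -/
theorem exists_norm_zero_le {N a P : ℝ} {g : ℝ → ℝ} (hg : IsGeneralizedBSpline N a g)
    (ha : 0 < a) (hP : N / 2 < P) (haP : a < P) {M : ℕ}
    (hM : a / 2 + M * (P - a) < N / 2) (hM' : N / 2 ≤ a / 2 + (M + 1) * (P - a)) :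
    ∃ K : ℝ, 0 ≤ K ∧ ∀ (x : ℝ) (c : ℤ → ℂ) (S : ℝ), |x| ≤ a / 2 →
      (∀ k : ℤ, |k| ≤ M → ‖row g a P x c k‖ ≤ S) → ‖c 0‖ ≤ K * S := by
  obtain ⟨K, hK, h⟩ := exists_norm_le_of_nonneg hg ha hP haP hM hM' M
  refine ⟨K, hK, fun x c S hx hrow => ?_⟩
  rcases le_total 0 x with hx0 | hx0
  · simpa using h x c S hx hrow le_rfl (by simpa using hx0)
  · -- `g` is even, so the reflected sequence solves the reflected system
    have hrefl : ∀ k : ℤ, row g a P (-x) (fun n => c (-n)) k = row g a P x c (-k) := fun k => by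
      have e1 : g (-x + k * (P - a)) = g (x + (-k : ℤ) * (P - a)) := by
        rw [← hg.even]; push_cast; ring_nf
      have e2 : g (-x + k * (P - a) + P) = g (x + (-k : ℤ) * (P - a) - P) := by
        rw [← hg.even]; push_cast; ring_nf
      have e3 : g (-x + k * (P - a) - P) = g (x + (-k : ℤ) * (P - a) + P) := by
        rw [← hg.even]; push_cast; ring_nf
      have e4 : -(k + 1) = -k - 1 := by ring
      have e5 : -(k - 1) = -k + 1 := by ring
      simp only [row, e1, e2, e3, e4, e5]
      ring
    simpa using h (-x) (fun n => c (-n)) S (by rwa [abs_neg])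
      (fun k hk => by rw [hrefl]; exact hrow _ (by rwa [abs_neg])) le_rfl (by simpa using hx0)

/-! ### The fibres of a function against the shifted windows -/

/-- The periodization `∑ₙ f (x + n P) g (x + n P - k a)` with period `P` of `f` times the shifted
window. -/
noncomputable def fibre (g : ℝ → ℝ) (a P : ℝ) (f : ℝ → ℂ) (k : ℤ) (x : ℝ) : ℂ :=
  ∑' n : ℤ, f (x + n * P) * g (x + n * P - k * a)

theorem fibre_add_zsmul (g : ℝ → ℝ) (a P : ℝ) (f : ℝ → ℂ) (k p : ℤ) (x : ℝ) :
    fibre g a P f k (p * P + x) = fibre g a P f k x := by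
  rw [fibre, fibre, ← (Equiv.addRight p).tsum_eq fun n : ℤ =>
    f (x + n * P) * (g (x + n * P - k * a) : ℂ)]
  refine tsum_congr fun n => ?_
  have : (p : ℝ) * P + x + n * P = x + ((Equiv.addRight p n : ℤ) : ℝ) * P := by
    simp only [Equiv.coe_addRight]; push_cast; ring
  rw [this]

theorem measurable_fibre {g : ℝ → ℝ} (hg : Measurable g) (a P : ℝ) {f : ℝ → ℂ}
    (hf : Measurable f) (k : ℤ) : Measurable (fibre g a P f k) := by
  unfold fibre
  fun_prop

theorem fibre_eq_row {N a P : ℝ} {g : ℝ → ℝ} (hg : IsGeneralizedBSpline N a g)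
    (hP : N / 2 < P) (f : ℝ → ℂ) (q k : ℤ) (x : ℝ)
    (hy : |x - q * a + k * (P - a)| < N / 2) :
    fibre g a P f (q + k) x = row g a P (x - q * a) (fun n => f (x + n * P)) k := by
  have hN : 0 < N / 2 := (abs_nonneg _).trans_lt hy
  rw [fibre, tsum_eq_sum (s := {k, k + 1, k - 1})]
  · rw [Finset.sum_insert (by simp; omega), Finset.sum_insert (by simp; omega), Finset.sum_singleton, row]
    push_cast
    have e1 : x + k * P - (q + k) * a = x - q * a + k * (P - a) := by ring
    have e2 : x + (k + 1) * P - (q + k) * a = x - q * a + k * (P - a) + P := by ring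
    have e3 : x + (k - 1) * P - (q + k) * a = x - q * a + k * (P - a) - P := by ring
    rw [e1, e2, e3, ← add_assoc]
  · intro n hn
    simp only [Finset.mem_insert, Finset.mem_singleton, not_or] at hn
    have hy' := abs_lt.1 hy
    have e1 : x + n * P - ((q + k : ℤ) : ℝ) * a
        = x - q * a + k * (P - a) + ((n - k : ℤ) : ℝ) * P := by push_cast; ring
    have hz : g (x + n * P - ((q + k : ℤ) : ℝ) * a) = 0 := by
      rw [e1]
      refine hg.eq_zero ?_
      rcases lt_or_ge n k with h | h
      · have h1 : ((n - k : ℤ) : ℝ) ≤ -2 := by exact_mod_cast (by omega : n - k ≤ -2)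
        refine le_trans ?_ (neg_le_abs _)
        nlinarith
      · have h1 : (2 : ℝ) ≤ ((n - k : ℤ) : ℝ) := by exact_mod_cast (by omega : 2 ≤ n - k)
        refine le_trans ?_ (le_abs_self _)
        nlinarith
    rw [hz, Complex.ofReal_zero, mul_zero]

/-- Pointwise form of the lower frame bound: `f` is recovered at `x` from the `2 M + 1` fibres
whose windows are centred closest to `x`. -/
theorem exists_sq_norm_le_sum_fibre {N a P : ℝ} {g : ℝ → ℝ} (hg : IsGeneralizedBSpline N a g)
    (ha : 0 < a) (hP : N / 2 < P) (haP : a < P) {M : ℕ}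
    (hM : a / 2 + M * (P - a) < N / 2) (hM' : N / 2 ≤ a / 2 + (M + 1) * (P - a)) :
    ∃ K : ℝ, 0 ≤ K ∧ ∀ (f : ℝ → ℂ) (q : ℤ) (x : ℝ), |x - q * a| ≤ a / 2 →
      ‖f x‖ ^ 2 ≤ K * ∑ j ∈ Finset.Icc (-M : ℤ) M, ‖fibre g a P f (q + j) x‖ ^ 2 := by
  obtain ⟨K, hK, h⟩ := exists_norm_zero_le hg ha hP haP hM hM'
  refine ⟨K ^ 2, by positivity, fun f q x hx => ?_⟩
  set W := ∑ j ∈ Finset.Icc (-M : ℤ) M, ‖fibre g a P f (q + j) x‖ ^ 2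
  have hW0 : 0 ≤ W := Finset.sum_nonneg fun _ _ => by positivity
  have hδ : 0 < P - a := by linarith
  have := h (x - q * a) (fun n => f (x + n * P)) (√W) hx fun k hk => by
    have hk' : |(k : ℝ)| ≤ M := by exact_mod_cast hk
    rw [← fibre_eq_row hg hP f q k x]
    · refine Real.le_sqrt_of_sq_le ?_
      exact Finset.single_le_sum (f := fun j => ‖fibre g a P f (q + j) x‖ ^ 2)
        (fun _ _ => by positivity) (Finset.mem_Icc.2 (abs_le.1 hk))
    · refine ((abs_add_le _ _).trans (add_le_add hx ?_)).trans_lt hM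
      rw [abs_mul, abs_of_pos hδ]
      gcongr
  simp only [Int.cast_zero, zero_mul, add_zero] at this
  calc ‖f x‖ ^ 2 ≤ (K * √W) ^ 2 := by gcongr
    _ = K ^ 2 * W := by rw [mul_pow, Real.sq_sqrt hW0]

/-! ### Parseval's identity for one window position -/

theorem norm_exp_mul_I_eq_one {z : ℂ} (r : ℝ) (h : z = r * Complex.I) : ‖Complex.exp z‖ = 1 := by
  rw [h, Complex.norm_exp_ofReal_mul_I]

/-- A function supported in two adjacent periods has the Fourier integrals of its periodization,
so Parseval's identity on one period gives their square sum. -/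
theorem hasSum_sq_norm_integral_exp_mul {P : ℝ} (hP : 0 < P) (t : ℝ) {φ : ℝ → ℂ}
    (hφ : MemLp φ 2 volume) (hsupp : ∀ x, x ∉ Set.Ioc (t - P) (t + P) → φ x = 0) :
    HasSum (fun ℓ : ℤ => ‖∫ x : ℝ,
        Complex.exp (2 * Real.pi * Complex.I * (-ℓ : ℤ) * x / P) * φ x‖ ^ 2)
      (P * ∫ x in t..t + P, ‖φ x + φ (x - P)‖ ^ 2) := by
  have hlt : t < t + P := by linarith
  have hP' : (P : ℂ) ≠ 0 := by exact_mod_cast hP.ne'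
  have hφ' : MemLp (fun x => φ (x - P)) 2 volume :=
    hφ.comp_measurePreserving (measurePreserving_sub_right volume P)
  have hmem : MemLp (fun x => φ x + φ (x - P)) 2 (volume.restrict (Set.Ioc t (t + P))) :=
    (hφ.add hφ').mono_measure Measure.restrict_le_self
  have hpars := (hasSum_sq_fourierCoeffOn hlt hmem).mul_left (P ^ 2)
  have hval : P ^ 2 * ((t + P - t)⁻¹ • ∫ x in t..t + P, ‖φ x + φ (x - P)‖ ^ 2)
      = P * ∫ x in t..t + P, ‖φ x + φ (x - P)‖ ^ 2 := by
    rw [add_sub_cancel_left, smul_eq_mul]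
    field_simp
  rw [hval] at hpars
  refine hpars.congr_fun fun ℓ => ?_
  set e : ℝ → ℂ := fun x => Complex.exp (2 * Real.pi * Complex.I * (-ℓ : ℤ) * x / P) with he
  have hec : Continuous e := by fun_prop
  have hper : ∀ x, e (x - P) = e x := fun x => by
    have : 2 * Real.pi * Complex.I * (-ℓ : ℤ) * ((x - P : ℝ) : ℂ) / P
        = 2 * Real.pi * Complex.I * (-ℓ : ℤ) * x / P + (ℓ : ℤ) * (2 * Real.pi * Complex.I) := by
      push_cast
      field_simp
      ring
    simp only [he]
    rw [this, Complex.exp_add, Complex.exp_int_mul_two_pi_mul_I, mul_one]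
  have hint : ∀ {ψ : ℝ → ℂ}, MemLp ψ 2 volume → ∀ u v : ℝ,
      IntervalIntegrable (fun x => e x * ψ x) volume u v := fun {ψ} hψ u v => by
    have h1 : MemLp (fun x => e x * ψ x) 2 volume := by
      refine hψ.of_le (hec.aestronglyMeasurable.mul hψ.1) (Filter.Eventually.of_forall fun x => ?_)
      rw [norm_mul, norm_exp_mul_I_eq_one (2 * Real.pi * (-ℓ : ℤ) * x / P) (by push_cast; ring),
        one_mul]
    rw [intervalIntegrable_iff, Set.uIoc]
    exact (h1.mono_measure Measure.restrict_le_self).integrable one_le_two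
  have hfold : ∫ x, e x * φ x = ∫ x in t..t + P, e x * (φ x + φ (x - P)) := by
    have h1 : ∫ x, e x * φ x = ∫ x in (t - P)..(t + P), e x * φ x := by
      rw [intervalIntegral.integral_of_le (by linarith)]
      refine (setIntegral_eq_integral_of_forall_compl_eq_zero fun x hx => ?_).symm
      rw [hsupp x hx, mul_zero]
    have h2 : ∫ x in (t - P)..t, e x * φ x = ∫ x in t..t + P, e x * φ (x - P) := by
      have := intervalIntegral.integral_comp_sub_right (a := t) (b := t + P)
        (fun x => e x * φ x) P
      rw [add_sub_cancel_right] at this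
      rw [← this]
      simp only [hper]
    rw [h1, ← intervalIntegral.integral_add_adjacent_intervals (hint hφ _ t) (hint hφ t _), h2,
      ← intervalIntegral.integral_add (hint hφ' _ _) (hint hφ _ _)]
    refine intervalIntegral.integral_congr fun x _ => ?_
    ring
  have hcoeff : fourierCoeffOn hlt (fun x => φ x + φ (x - P)) ℓ
      = (1 / P) • ∫ x in t..t + P, e x * (φ x + φ (x - P)) := by
    rw [fourierCoeffOn_eq_integral]
    simp only [fourier_coe_apply, smul_eq_mul, he, add_sub_cancel_left]
  rw [hcoeff, ← hfold, norm_smul, Real.norm_of_nonneg (by positivity), mul_pow]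
  field_simp
  rfl

theorem tsum_sq_enorm_integral_exp_mul {P : ℝ} (hP : 0 < P) (t : ℝ) {φ : ℝ → ℂ}
    (hφ : MemLp φ 2 volume) (hsupp : ∀ x, x ∉ Set.Ioc (t - P) (t + P) → φ x = 0) :
    ∑' ℓ : ℤ, ‖∫ x : ℝ, Complex.exp (2 * Real.pi * Complex.I * (-ℓ : ℤ) * x / P) * φ x‖ₑ ^ 2
      = ENNReal.ofReal P * ∫⁻ x in Set.Ioc t (t + P), ‖φ x + φ (x - P)‖ₑ ^ 2 := by
  have h := hasSum_sq_norm_integral_exp_mul hP t hφ hsupp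
  have hφ' : MemLp (fun x => φ (x - P)) 2 volume :=
    hφ.comp_measurePreserving (measurePreserving_sub_right volume P)
  have hI : Integrable (fun x => ‖φ x + φ (x - P)‖ ^ 2) (volume.restrict (Set.Ioc t (t + P))) :=
    ((hφ.add hφ').mono_measure Measure.restrict_le_self).norm.integrable_sq
  simp only [← ofReal_norm, ← ENNReal.ofReal_pow (norm_nonneg _)]
  rw [← ENNReal.ofReal_tsum_of_nonneg (fun _ => by positivity) h.summable, h.tsum_eq,
    ENNReal.ofReal_mul hP.le, intervalIntegral.integral_of_le (by linarith),
    ofReal_integral_eq_lintegral_ofReal hI (Filter.Eventually.of_forall fun _ => by positivity)]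

/-! ### Frame bounds for the fibres -/

theorem fibre_eq_add {N a P : ℝ} {g : ℝ → ℝ} (hg : IsGeneralizedBSpline N a g)
    (hN : 0 ≤ N) (hP : N / 2 < P) (f : ℝ → ℂ) (k : ℤ) {x : ℝ}
    (hx : x ∈ Set.Ioc (k * a) (k * a + P)) :
    fibre g a P f k x = f x * g (x - k * a) + f (x - P) * g (x - P - k * a) := by
  rw [fibre, tsum_eq_sum (s := {0, -1})]
  · rw [Finset.sum_insert (by simp), Finset.sum_singleton]
    simp [sub_eq_add_neg]
  · intro n hn
    simp only [Finset.mem_insert, Finset.mem_singleton, not_or] at hn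
    have hz : g (x + n * P - k * a) = 0 := by
      refine hg.eq_zero ?_
      rcases lt_or_ge n 0 with h | h
      · have h1 : (n : ℝ) ≤ -2 := by exact_mod_cast (by omega : n ≤ -2)
        refine le_trans ?_ (neg_le_abs _)
        nlinarith [hx.2]
      · have h1 : (1 : ℝ) ≤ n := by exact_mod_cast (by omega : 1 ≤ n)
        refine le_trans ?_ (le_abs_self _)
        nlinarith [hx.1]
    rw [hz, Complex.ofReal_zero, mul_zero]

/-- The square norm of a fibre has the same integral over every period. -/
theorem setLIntegral_fibre_eq {P : ℝ} (hP : 0 < P) (g : ℝ → ℝ) (a : ℝ) (f : ℝ → ℂ) (k : ℤ)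
    (s t : ℝ) :
    ∫⁻ x in Set.Ioc s (s + P), ‖fibre g a P f k x‖ₑ ^ 2
      = ∫⁻ x in Set.Ioc t (t + P), ‖fibre g a P f k x‖ₑ ^ 2 := by
  refine (isAddFundamentalDomain_Ioc hP s).setLIntegral_eq (isAddFundamentalDomain_Ioc hP t) _ ?_
  rintro ⟨_, p, rfl⟩ x
  have : (⟨(fun n : ℤ => n • P) p, ⟨p, rfl⟩⟩ : AddSubgroup.zmultiples P) +ᵥ x = p * P + x := by
    simp [AddSubgroup.vadd_def]
  rw [this, fibre_add_zsmul]

theorem lintegral_sq_enorm_le_tsum_fibre {a P K : ℝ} (ha : 0 < a) (haP : a < P) (hK : 0 ≤ K)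
    {g : ℝ → ℝ} (hg : Measurable g) {f : ℝ → ℂ} (hf : Measurable f) {M : ℕ}
    (h : ∀ (q : ℤ) (x : ℝ), |x - q * a| ≤ a / 2 →
      ‖f x‖ ^ 2 ≤ K * ∑ j ∈ Finset.Icc (-M : ℤ) M, ‖fibre g a P f (q + j) x‖ ^ 2) :
    ∫⁻ x, ‖f x‖ₑ ^ 2 ≤ ENNReal.ofReal (K * (2 * M + 1)) *
      ∑' k : ℤ, ∫⁻ x in Set.Ioc (k * a) (k * a + P), ‖fibre g a P f k x‖ₑ ^ 2 := by
  set E : ℤ → ENNReal := fun k =>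
    ∫⁻ x in Set.Ioc (k * a) (k * a + P), ‖fibre g a P f k x‖ₑ ^ 2 with hE
  have hmeas : ∀ k, Measurable fun x => ‖fibre g a P f k x‖ₑ ^ 2 := fun k =>
    (measurable_fibre hg a P hf k).enorm.pow_const 2
  have hpt : ∀ (q : ℤ) (x : ℝ), |x - q * a| ≤ a / 2 → ‖f x‖ₑ ^ 2 ≤
      ENNReal.ofReal K * ∑ j ∈ Finset.Icc (-M : ℤ) M, ‖fibre g a P f (q + j) x‖ₑ ^ 2 :=
    fun q x hx => by
      simp only [← ofReal_norm, ← ENNReal.ofReal_pow (norm_nonneg _)]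
      rw [← ENNReal.ofReal_sum_of_nonneg fun _ _ => by positivity, ← ENNReal.ofReal_mul hK]
      exact ENNReal.ofReal_le_ofReal (h q x hx)
  have hcell : ∀ q : ℤ, ∫⁻ x in Set.Ioc (-(a / 2) + q • a) (-(a / 2) + (q + 1) • a), ‖f x‖ₑ ^ 2
      ≤ ENNReal.ofReal K * ∑ j ∈ Finset.Icc (-M : ℤ) M, E (q + j) := fun q => by
    simp only [zsmul_eq_mul, Int.cast_add, Int.cast_one]
    calc _ ≤ ∫⁻ x in Set.Ioc (-(a / 2) + q * a) (-(a / 2) + (q + 1) * a), ENNReal.ofReal K *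
            ∑ j ∈ Finset.Icc (-M : ℤ) M, ‖fibre g a P f (q + j) x‖ₑ ^ 2 := by
          refine setLIntegral_mono' measurableSet_Ioc fun x hx => hpt q x (abs_le.2 ⟨?_, ?_⟩)
          · linarith [hx.1]
          · linarith [hx.2]
      _ = ENNReal.ofReal K * ∑ j ∈ Finset.Icc (-M : ℤ) M,
            ∫⁻ x in Set.Ioc (-(a / 2) + q * a) (-(a / 2) + (q + 1) * a),
              ‖fibre g a P f (q + j) x‖ₑ ^ 2 := by
          rw [lintegral_const_mul _ (Finset.measurable_fun_sum _ fun _ _ => hmeas _),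
            lintegral_finsetSum _ fun _ _ => hmeas _]
      _ ≤ _ := by
          gcongr with j
          simp only [hE]
          -- a cell of length `a` fits into one period
          rw [setLIntegral_fibre_eq (ha.trans haP) g a f (q + j) _ (-(a / 2) + q * a)]
          refine lintegral_mono_set (Set.Ioc_subset_Ioc_right ?_)
          linarith
  have hdisj := Set.pairwise_disjoint_Ioc_add_zsmul (-(a / 2)) a
  calc ∫⁻ x, ‖f x‖ₑ ^ 2
      = ∑' q : ℤ, ∫⁻ x in Set.Ioc (-(a / 2) + q • a) (-(a / 2) + (q + 1) • a), ‖f x‖ₑ ^ 2 := by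
        rw [← lintegral_iUnion (fun _ => measurableSet_Ioc) hdisj, iUnion_Ioc_add_zsmul ha,
          Measure.restrict_univ]
    _ ≤ ∑' q : ℤ, ENNReal.ofReal K * ∑ j ∈ Finset.Icc (-M : ℤ) M, E (q + j) :=
        ENNReal.tsum_le_tsum hcell
    _ = ENNReal.ofReal K * ∑ j ∈ Finset.Icc (-M : ℤ) M, ∑' k, E k := by
        rw [ENNReal.tsum_mul_left, Summable.tsum_finsetSum fun _ _ => ENNReal.summable]
        congr 1
        exact Finset.sum_congr rfl fun j _ => (Equiv.addRight j).tsum_eq E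
    _ = _ := by
        have hcard : (((M : ℤ) + 1 - -(M : ℤ)).toNat : ENNReal) = ENNReal.ofReal (2 * M + 1) := by
          rw [← ENNReal.ofReal_natCast]
          congr 1
          have : ((M : ℤ) + 1 - -(M : ℤ)).toNat = 2 * M + 1 := by omega
          rw [this]
          push_cast
          ring
        rw [Finset.sum_const, Int.card_Icc, nsmul_eq_mul, ENNReal.ofReal_mul hK, hcard, mul_assoc]

/-- The shifted windows overlap boundedly often. -/
theorem exists_tsum_sq_enorm_le {N a : ℝ} {g : ℝ → ℝ} (hg : IsGeneralizedBSpline N a g)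
    (ha : 0 < a) :
    ∃ C : ℝ, 0 < C ∧ ∀ x : ℝ, ∑' k : ℤ, ‖(g (x - k * a) : ℂ)‖ₑ ^ 2 ≤ ENNReal.ofReal C := by
  obtain ⟨J, hJ⟩ := exists_nat_ge ((N / 2 + a) / a)
  rw [div_le_iff₀ ha] at hJ
  refine ⟨(Finset.Icc (-J : ℤ) J).card * g 0 ^ 2 + 1,
    add_pos_of_nonneg_of_pos (by positivity) one_pos, fun x => ?_⟩
  rw [← (Equiv.addRight ⌊x / a⌋).tsum_eq, tsum_eq_sum (s := Finset.Icc (-J : ℤ) J)]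
  · have hle : ∀ k ∈ Finset.Icc (-J : ℤ) J,
        ‖(g (x - (Equiv.addRight ⌊x / a⌋ k : ℤ) * a) : ℂ)‖ₑ ^ 2 ≤ ENNReal.ofReal (g 0 ^ 2) :=
      fun k _ => by
        rw [← ofReal_norm, ← ENNReal.ofReal_pow (norm_nonneg _), Complex.norm_real,
          Real.norm_of_nonneg (hg.nonneg _)]
        exact ENNReal.ofReal_le_ofReal (pow_le_pow_left₀ (hg.nonneg _) (hg.le_apply_zero _) 2)
    refine (Finset.sum_le_card_nsmul _ _ _ hle).trans ?_
    rw [nsmul_eq_mul, ← ENNReal.ofReal_natCast, ← ENNReal.ofReal_mul (by positivity)]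
    exact ENNReal.ofReal_le_ofReal (by linarith)
  · intro k hk
    have h1 := Int.floor_le (x / a)
    have h2 := Int.lt_floor_add_one (x / a)
    rw [le_div_iff₀ ha] at h1
    rw [div_lt_iff₀ ha] at h2
    have hz : g (x - (Equiv.addRight ⌊x / a⌋ k : ℤ) * a) = 0 := by
      refine hg.eq_zero ?_
      simp only [Equiv.coe_addRight, Int.cast_add]
      rw [Finset.mem_Icc, not_and_or, not_le, not_le] at hk
      rcases hk with hk | hk
      · have h3 : (k : ℝ) ≤ -J := by exact_mod_cast hk.le
        refine le_trans ?_ (le_abs_self _)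
        nlinarith
      · have h3 : (J : ℝ) ≤ k := by exact_mod_cast hk.le
        refine le_trans ?_ (neg_le_abs _)
        nlinarith
    rw [hz]
    simp

theorem exists_tsum_fibre_le {N a P : ℝ} {g : ℝ → ℝ} (hg : IsGeneralizedBSpline N a g)
    (hN : 0 ≤ N) (ha : 0 < a) (hP : N / 2 < P) :
    ∃ D : ℝ, 0 < D ∧ ∀ f : ℝ → ℂ, Measurable f →
      ∑' k : ℤ, ∫⁻ x in Set.Ioc (k * a) (k * a + P), ‖fibre g a P f k x‖ₑ ^ 2
        ≤ ENNReal.ofReal D * ∫⁻ x, ‖f x‖ₑ ^ 2 := by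
  obtain ⟨C, hC, hCle⟩ := exists_tsum_sq_enorm_le hg ha
  refine ⟨4 * C, by positivity, fun f hf => ?_⟩
  set φ : ℤ → ℝ → ℂ := fun k x => f x * g (x - k * a) with hφ
  have hgm := hg.continuous.measurable
  have hφm : ∀ k, Measurable (φ k) := fun k => by fun_prop
  have hsq : ∀ z w : ℂ, ‖z + w‖ₑ ^ 2 ≤ 2 * ‖z‖ₑ ^ 2 + 2 * ‖w‖ₑ ^ 2 := fun z w => by
    have h1 : ‖z + w‖ ^ 2 ≤ 2 * ‖z‖ ^ 2 + 2 * ‖w‖ ^ 2 := by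
      nlinarith [norm_add_le z w, norm_nonneg (z + w), sq_nonneg (‖z‖ - ‖w‖)]
    have h2 : (2 : ENNReal) = ENNReal.ofReal 2 := by simp
    simp only [← ofReal_norm, ← ENNReal.ofReal_pow (norm_nonneg _)]
    rw [h2, ← ENNReal.ofReal_mul zero_le_two, ← ENNReal.ofReal_mul zero_le_two,
      ← ENNReal.ofReal_add (by positivity) (by positivity)]
    exact ENNReal.ofReal_le_ofReal h1
  have hk : ∀ k : ℤ, ∫⁻ x in Set.Ioc (k * a) (k * a + P), ‖fibre g a P f k x‖ₑ ^ 2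
      ≤ 4 * ∫⁻ x, ‖φ k x‖ₑ ^ 2 := fun k => by
    have hm : Measurable fun x => 2 * ‖φ k x‖ₑ ^ 2 := by fun_prop
    calc _ ≤ ∫⁻ x in Set.Ioc (k * a) (k * a + P),
            (2 * ‖φ k x‖ₑ ^ 2 + 2 * ‖φ k (x - P)‖ₑ ^ 2) :=
          setLIntegral_mono' measurableSet_Ioc fun x hx => by
            rw [fibre_eq_add hg hN hP f k hx]
            exact hsq _ _
      _ ≤ ∫⁻ x, (2 * ‖φ k x‖ₑ ^ 2 + 2 * ‖φ k (x - P)‖ₑ ^ 2) := setLIntegral_le_lintegral _ _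
      _ = _ := by
          rw [lintegral_add_left hm,
            lintegral_sub_right_eq_self (fun x => 2 * ‖φ k x‖ₑ ^ 2) P,
            lintegral_const_mul _ (by fun_prop), ← add_mul]
          norm_num
  calc _ ≤ ∑' k : ℤ, 4 * ∫⁻ x, ‖φ k x‖ₑ ^ 2 := ENNReal.tsum_le_tsum hk
    _ = 4 * ∫⁻ x, ∑' k : ℤ, ‖φ k x‖ₑ ^ 2 := by
        rw [ENNReal.tsum_mul_left, lintegral_tsum fun k => by fun_prop]
    _ ≤ 4 * ∫⁻ x, ENNReal.ofReal C * ‖f x‖ₑ ^ 2 := by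
        gcongr with x
        simp only [hφ, enorm_mul, mul_pow]
        rw [ENNReal.tsum_mul_left, mul_comm]
        gcongr
        exact hCle x
    _ = _ := by
        rw [lintegral_const_mul _ (by fun_prop), ENNReal.ofReal_mul (by norm_num), mul_assoc]
        norm_num

/-! ### From fibres to the Gabor system -/

theorem Lp_enorm_sq_eq_lintegral (f : Lp ℂ 2 (volume : Measure ℝ)) :
    ‖f‖ₑ ^ 2 = ∫⁻ x, ‖f x‖ₑ ^ 2 := by
  have := eLpNorm_nnreal_pow_eq_lintegral (μ := (volume : Measure ℝ)) (f := (f : ℝ → ℂ))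
    (p := 2) two_ne_zero
  rw [Lp.enorm_def]
  simpa using this

theorem isHilbertFrame_of_enorm {ι H : Type*} [NormedAddCommGroup H] [InnerProductSpace ℂ H]
    {φ : ι → H} {C D : ℝ} (hC : 0 < C) (hD : 0 < D)
    (hlow : ∀ f : H, ‖f‖ₑ ^ 2 ≤ ENNReal.ofReal C * ∑' i, ‖inner ℂ (φ i) f‖ₑ ^ 2)
    (hup : ∀ f : H, ∑' i, ‖inner ℂ (φ i) f‖ₑ ^ 2 ≤ ENNReal.ofReal D * ‖f‖ₑ ^ 2) :
    IsHilbertFrame φ := by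
  refine ⟨C⁻¹, D, by positivity, hD, fun f => ?_⟩
  have hl := hlow f
  have hu := hup f
  simp only [← ofReal_norm, ← ENNReal.ofReal_pow (norm_nonneg _)] at hl hu
  rw [← ENNReal.ofReal_mul hD.le] at hu
  have hsum : Summable fun i => ‖inner ℂ (φ i) f‖ ^ 2 := by
    have := ENNReal.summable_toReal (hu.trans_lt ENNReal.ofReal_lt_top).ne
    simpa only [ENNReal.toReal_ofReal (sq_nonneg _)] using this
  have hnn : ∀ i, 0 ≤ ‖inner ℂ (φ i) f‖ ^ 2 := fun i => by positivity
  rw [← ENNReal.ofReal_tsum_of_nonneg hnn hsum] at hl hu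
  rw [← ENNReal.ofReal_mul hC.le, ENNReal.ofReal_le_ofReal_iff
    (mul_nonneg hC.le (tsum_nonneg hnn))] at hl
  rw [ENNReal.ofReal_le_ofReal_iff (by positivity)] at hu
  exact ⟨hsum, by rwa [inv_mul_le_iff₀ hC], hu⟩

/-- The coefficients of `f` against all modulations of one shifted window carry the energy of one
fibre. -/
theorem tsum_sq_enorm_inner_gaborSystem {N a b : ℝ} {g : ℝ → ℝ}
    (hg : IsGeneralizedBSpline N a g) (hN : 0 ≤ N) (hb : 0 < b) (hP : N / 2 < b⁻¹)
    (hg2 : MemLp (fun x => (g x : ℂ)) 2 volume) (f : Lp ℂ 2 (volume : Measure ℝ)) (k : ℤ) :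
    ∑' ℓ : ℤ, ‖inner ℂ (gaborSystem (fun x => (g x : ℂ)) hg2 a b (ℓ, k)) f‖ₑ ^ 2
      = ENNReal.ofReal b⁻¹ *
        ∫⁻ x in Set.Ioc (k * a) (k * a + b⁻¹), ‖fibre g a b⁻¹ f k x‖ₑ ^ 2 := by
  have hPpos : 0 < b⁻¹ := by positivity
  have hφ : MemLp (fun x => f x * (g (x - k * a) : ℂ)) 2 volume := by
    have h1 : Continuous fun x => (g (x - k * a) : ℂ) := by
      have := hg.continuous
      fun_prop
    refine ((Lp.memLp f).const_mul (g 0 : ℂ)).of_le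
      ((Lp.aestronglyMeasurable f).mul h1.aestronglyMeasurable)
      (Filter.Eventually.of_forall fun x => ?_)
    rw [norm_mul, norm_mul, mul_comm, Complex.norm_real, Complex.norm_real,
      Real.norm_of_nonneg (hg.nonneg _), Real.norm_of_nonneg (hg.nonneg _)]
    exact mul_le_mul_of_nonneg_right (hg.le_apply_zero _) (norm_nonneg _)
  have hsupp : ∀ x, x ∉ Set.Ioc (k * a - b⁻¹) (k * a + b⁻¹) → f x * (g (x - k * a) : ℂ) = 0 :=
    fun x hx => by
      have hz : g (x - k * a) = 0 := by
        refine hg.eq_zero ?_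
        rw [Set.mem_Ioc, not_and_or, not_lt, not_le] at hx
        rcases hx with hx | hx
        · exact le_trans (by linarith) (neg_le_abs _)
        · exact le_trans (by linarith) (le_abs_self _)
      rw [hz, Complex.ofReal_zero, mul_zero]
  have hfib : ∫⁻ x in Set.Ioc (k * a) (k * a + b⁻¹), ‖fibre g a b⁻¹ f k x‖ₑ ^ 2
      = ∫⁻ x in Set.Ioc (k * a) (k * a + b⁻¹),
        ‖f x * (g (x - k * a) : ℂ) + f (x - b⁻¹) * (g (x - b⁻¹ - k * a) : ℂ)‖ₑ ^ 2 :=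
    setLIntegral_congr_fun measurableSet_Ioc fun x hx => by
      simp only [fibre_eq_add hg hN hP f k hx]
  rw [hfib, ← tsum_sq_enorm_integral_exp_mul hPpos (k * a) hφ hsupp]
  refine tsum_congr fun ℓ => ?_
  rw [L2.inner_def]
  congr 2
  refine integral_congr_ae ?_
  filter_upwards [(memLp_gaborAtom hg2 a b ℓ k).coeFn_toLp] with x hx
  rw [gaborSystem, hx, gaborAtom, RCLike.inner_apply, map_mul, Complex.conj_ofReal,
    ← Complex.exp_conj]
  simp only [map_mul, Complex.conj_I, Complex.conj_ofReal, map_ofNat, map_intCast]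
  have : 2 * Real.pi * Complex.I * (-ℓ : ℤ) * x / (b⁻¹ : ℝ)
      = 2 * Real.pi * -Complex.I * ℓ * b * x := by
    push_cast
    rw [div_inv_eq_mul]
    ring
  rw [this]
  ring

/-- The part of the hypothesis `(a, b) ∈ T` that the frame property rests on, with `M = m - 1` for
`(a, b) ∈ T_m`: the diagonal positions `x + k (b⁻¹ - a)` with `|x| ≤ a / 2` and `|k| ≤ M` lie in the
support of the window, and `M` is the largest such bound. -/
theorem exists_nat_of_mem_unionT {N a b : ℝ} (hN : 0 < N) (h : (a, b) ∈ unionT N) :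
    0 < b ∧ a < N / 2 ∧ N / 2 < b⁻¹ ∧ ∃ M : ℕ, a / 2 + M * (b⁻¹ - a) < N / 2 ∧
      N / 2 ≤ a / 2 + (M + 1) * (b⁻¹ - a) := by
  simp only [unionT, Set.mem_iUnion] at h
  obtain ⟨m, hm, h⟩ := h
  have hinv : 0 < b → b < 2 / N → N / 2 < b⁻¹ := fun hb hbN => by
    rw [lt_inv_comm₀ (by positivity) hb, inv_div]
    exact hbN
  by_cases h1 : m = 1
  · rw [regionT, if_pos h1] at h
    obtain ⟨ha, hb, haN, hb2, hbN⟩ := h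
    simp only at ha hb haN hb2 hbN
    refine ⟨hb, haN.2, hinv hb hbN, 0, ?_, ?_⟩
    · simp only [Nat.cast_zero, zero_mul, add_zero]
      linarith [haN.2]
    · have h3 : (N + a) / 2 ≤ b⁻¹ := by
        rw [le_inv_comm₀ (by positivity) hb, inv_div]
        exact hb2.2
      simp only [Nat.cast_zero, zero_add, one_mul]
      linarith
  · rw [regionT, if_neg h1] at h
    obtain ⟨ha, hb, haN, hb2, hbN⟩ := h
    simp only at ha hb haN hb2 hbN
    obtain ⟨n, rfl⟩ : ∃ n, m = n + 2 := ⟨m - 2, by omega⟩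
    push_cast at hb2
    have hn : (0 : ℝ) ≤ n := n.cast_nonneg
    have hp1 : 0 < N + (2 * (n + 2 : ℝ) - 3) * a := by
      have : 0 < (2 * (n + 2 : ℝ) - 3) := by linarith
      positivity
    have hp2 : 0 < N + (2 * (n + 2 : ℝ) - 1) * a := by
      have : 0 < (2 * (n + 2 : ℝ) - 1) := by linarith
      positivity
    have hcancel : ∀ X : ℝ, b⁻¹ * (b * X) = X := inv_mul_cancel_left₀ hb.ne'
    have hlow := mul_lt_mul_of_pos_left ((div_lt_iff₀ hp1).1 hb2.1) (inv_pos.2 hb)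
    have hup := mul_le_mul_of_nonneg_left ((le_div_iff₀ hp2).1 hb2.2) (inv_pos.2 hb).le
    rw [hcancel] at hlow hup
    refine ⟨hb, haN.2, hinv hb hbN, n + 1, ?_, ?_⟩
    · push_cast
      linarith
    · push_cast
      linarith

end GaborFrames

open GaborFrames

theorem corollary1p3 (N a b : ℝ) (hN : 2 ≤ N) (ha : 0 < a) (g : ℝ → ℝ)
    (hg : GaborFrames.IsGeneralizedBSpline N a g) (hab : (a, b) ∈ GaborFrames.unionT N) :
    GaborFrames.IsGaborFrame (fun x => (g x : ℂ)) a b := by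
  obtain ⟨hb, haN, hP, M, hM, hM'⟩ := exists_nat_of_mem_unionT (by linarith) hab
  have haP : a < b⁻¹ := haN.trans hP
  have hPpos : 0 < b⁻¹ := by positivity
  have hg2 : MemLp (fun x => (g x : ℂ)) 2 volume := by
    have hc : Continuous fun x => (g x : ℂ) := Complex.continuous_ofReal.comp hg.continuous
    refine hc.memLp_of_hasCompactSupport (HasCompactSupport.intro isCompact_Icc
      (K := Set.Icc (-(N / 2)) (N / 2)) fun x hx => ?_)
    rw [hg.eq_zero, Complex.ofReal_zero]
    by_contra hlt
    exact hx (abs_le.1 (not_le.1 hlt).le)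
  obtain ⟨K, hK, hpt⟩ := exists_sq_norm_le_sum_fibre hg ha hP haP hM hM'
  obtain ⟨D, hD, hup⟩ := exists_tsum_fibre_le hg (by linarith) ha hP
  -- `K + 1` in place of `K` makes the constant positive
  have hpt' : ∀ (f : ℝ → ℂ) (q : ℤ) (x : ℝ), |x - q * a| ≤ a / 2 → ‖f x‖ ^ 2 ≤
      (K + 1) * ∑ j ∈ Finset.Icc (-M : ℤ) M, ‖fibre g a b⁻¹ f (q + j) x‖ ^ 2 := fun f q x hx =>
    (hpt f q x hx).trans <| mul_le_mul_of_nonneg_right (by linarith) <|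
      Finset.sum_nonneg fun _ _ => by positivity
  have henergy : ∀ f : Lp ℂ 2 (volume : Measure ℝ),
      ∑' p, ‖inner ℂ (gaborSystem (fun x => (g x : ℂ)) hg2 a b p) f‖ₑ ^ 2 = ENNReal.ofReal b⁻¹ *
        ∑' k : ℤ, ∫⁻ x in Set.Ioc (k * a) (k * a + b⁻¹), ‖fibre g a b⁻¹ f k x‖ₑ ^ 2 := fun f => by
    rw [← (Equiv.prodComm ℤ ℤ).tsum_eq, ENNReal.tsum_prod', ← ENNReal.tsum_mul_left]
    exact tsum_congr fun k =>
      tsum_sq_enorm_inner_gaborSystem hg (by linarith) hb hP hg2 f k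
  refine ⟨hg2, isHilbertFrame_of_enorm (C := (K + 1) * (2 * M + 1) * b) (D := b⁻¹ * D)
    (by positivity) (by positivity) (fun f => ?_) (fun f => ?_)⟩
  · rw [henergy, Lp_enorm_sq_eq_lintegral, ← mul_assoc, ← ENNReal.ofReal_mul (by positivity),
      mul_inv_cancel_right₀ hb.ne']
    exact lintegral_sq_enorm_le_tsum_fibre ha haP (by linarith) hg.continuous.measurable
      (Lp.stronglyMeasurable f).measurable (hpt' f)
  · rw [henergy, Lp_enorm_sq_eq_lintegral, ENNReal.ofReal_mul hPpos.le, mul_assoc]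
    gcongr
    exact hup f (Lp.stronglyMeasurable f).measurable
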